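/- Let $\mu$ be a finite positive Borel measure on $\mathbb{C}$ with compact, infinite support. Let $P^2(\mu)$ be the closure of the complex polynomials $\mathbb{C}[z]$ in $L^2(\mu)$, let $P$ be the orthogonal projection of $L^2(\mu)$ onto $P^2(\mu)$, let $M$ be the operator of multiplication by $z$ on $L^2(\mu)$, and consider the Hankel operator $T=[M^*,P]=M^*P-PM^*$ on $L^2(\mu)$. It is Hilbert-Schmidt; let $\kappa_0\ge\kappa_1\ge\dots\ge 0$ be its singular numbers, that is, the eigenvalues of $|T|=(T^*T)^{1/2}$ in decreasing order, repeated according to multiplicity, and followed by zeros if $T$ has finite rank. The operator $T$ has a Schmidt expansion $$T=\sum_{j=0}^\infty \kappa_j\, g_j\,\langle\,\cdot\,,f_j\rangle ,$$ convergent at every vector of $L^2(\mu)$, where $(f_j)_{j\ge 0}$ is an orthonormal sequence in $P^2(\mu)$ (the Schmidt vectors), $g_j\in P^2(\mu)^\perp$ for all $j$, and the $g_j$ with $\kappa_j\neq 0$ are orthonormal. If $Q$ is an orthogonal projection of $L^2(\mu)$ of finite rank $d\ge 0$ whose range is contained in $P^2(\mu)$, then $$\|[M^*,P](I-Q)\|_{HS}^2\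 \ge\ \sum_{j\ge d}\kappa_j^2 .$$ Moreover, for every such Schmidt expansion and every $d\ge 0$, equality holds when $Q$ is the orthogonal projection onto the span of $f_0,\dots,f_{d-1}$. -/

import Mathlib

open MeasureTheory Filter
open scoped ENNReal InnerProductSpace

noncomputable section

section HilbertSpace

variable {H : Type*} [NormedAddCommGroup H] [InnerProductSpace ℂ H] [CompleteSpace H]

/-- The index set of an orthonormal basis of `H`. -/
def stdBasisSet (H : Type*) [NormedAddCommGroup H] [InnerProductSpace ℂ H] [CompleteSpace H] :
    Set H :=
  Classical.choose (exists_hilbertBasis ℂ H)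

/-- An orthonormal basis of the Hilbert space `H`. -/
def stdBasis (H : Type*) [NormedAddCommGroup H] [InnerProductSpace ℂ H] [CompleteSpace H] :
    HilbertBasis (stdBasisSet H) ℂ H :=
  Classical.choose (Classical.choose_spec (exists_hilbertBasis ℂ H))

/-- The squared Hilbert-Schmidt norm `∑ ‖T eᵢ‖²` of a bounded operator, with value `∞` if the
operator is not Hilbert-Schmidt. By `hsNormSq_eq` it does not depend on the orthonormal basis. -/
def hsNormSq (T : H →L[ℂ] H) : ℝ≥0∞ :=
  ∑' i, ‖T (stdBasis H i)‖ₑ ^ 2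

/-- Parseval's identity. -/
theorem parseval_enorm {ι : Type*} (b : HilbertBasis ι ℂ H) (x : H) :
    ‖x‖ₑ ^ 2 = ∑' i, ‖⟪x, b i⟫_ℂ‖ₑ ^ 2 := by
  have h := b.hasSum_inner_mul_inner x x
  have h' : HasSum (fun i => ‖⟪x, b i⟫_ℂ‖ ^ 2) (‖x‖ ^ 2) := by
    have h2 := Complex.hasSum_re h
    convert h2 using 1
    · ext i
      rw [← inner_conj_symm (b i) x, Complex.mul_conj, Complex.ofReal_re, Complex.normSq_eq_norm_sq]
    · rw [inner_self_eq_norm_sq_to_K]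
      norm_cast
  rw [← ofReal_norm, ← ENNReal.ofReal_pow (norm_nonneg _), ← h'.tsum_eq,
    ENNReal.ofReal_tsum_of_nonneg (fun i => by positivity) h'.summable]
  congr 1
  ext i
  rw [← ofReal_norm, ← ENNReal.ofReal_pow (norm_nonneg _)]

theorem tsum_enorm_adjoint {ι κ : Type*} (b : HilbertBasis ι ℂ H) (c : HilbertBasis κ ℂ H)
    (T : H →L[ℂ] H) :
    ∑' i, ‖T (b i)‖ₑ ^ 2 = ∑' k, ‖(ContinuousLinearMap.adjoint T) (c k)‖ₑ ^ 2 := by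
  simp_rw [parseval_enorm c (T _), parseval_enorm b ((ContinuousLinearMap.adjoint T) _)]
  rw [ENNReal.tsum_comm]
  congr 1
  ext k
  congr 1
  ext i
  rw [ContinuousLinearMap.adjoint_inner_left, ← inner_conj_symm (c k), RCLike.enorm_conj]

theorem hsNormSq_eq {ι : Type*} (b : HilbertBasis ι ℂ H) (T : H →L[ℂ] H) :
    hsNormSq T = ∑' i, ‖T (b i)‖ₑ ^ 2 := by
  rw [hsNormSq, tsum_enorm_adjoint (stdBasis H) b T, tsum_enorm_adjoint b b T]

/-- The `j`-th singular number (`j = 0, 1, 2, …`) of a compact operator `T`: the `j`-th eigenvalue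
of the modulus `|T| = (T* T)^{1/2}`, the eigenvalues being listed in decreasing order and repeated
according to multiplicity. It is the largest `t ≥ 0` such that `T* T` has at least `j + 1`
orthonormal eigenvectors whose eigenvalues `sᵢ²` satisfy `sᵢ ≥ t` (and `0` if there is none). -/
def singularNumber (T : H →L[ℂ] H) (j : ℕ) : ℝ :=
  sSup {t : ℝ | 0 ≤ t ∧ ∃ (v : Fin (j + 1) → H) (s : Fin (j + 1) → ℝ), Orthonormal ℂ v ∧
    ∀ i, t ≤ s i ∧ (ContinuousLinearMap.adjoint T) (T (v i)) = (((s i) ^ 2 : ℝ) : ℂ) • v i}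

/-- `T = ∑ⱼ κⱼ gⱼ ⟨·, fⱼ⟩` is a Schmidt expansion of the operator `T`, which maps the subspace `V`
to its orthogonal complement and vanishes on the latter. The `κⱼ` are the singular numbers of `T`,
the Schmidt vectors `fⱼ` are orthonormal in `V`, and the `gⱼ` with `κⱼ ≠ 0` are orthonormal in the
complement of `V`. If `T` has finite rank, the sequence `fⱼ` is continued by null vectors of `T`. -/
structure IsSchmidtExpansion (V : Submodule ℂ H) (T : H →L[ℂ] H) (f g : ℕ → H) : Prop where
  orthonormal_f : Orthonormal ℂ f
  mem_f : ∀ j, f j ∈ V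
  orthonormal_g : Orthonormal ℂ (fun j : {j : ℕ // singularNumber T j ≠ 0} => g j)
  mem_g : ∀ j, g j ∈ Vᗮ
  expansion : ∀ h : H, HasSum (fun j => ((singularNumber T j : ℝ) : ℂ) • ⟪f j, h⟫_ℂ • g j) (T h)

end HilbertSpace

/-- The identity function `z` is bounded on the support of `μ`. -/
theorem memLp_coord (μ : Measure ℂ) (hc : IsCompact μ.support) :
    MemLp (fun z : ℂ => z) ∞ μ := by
  obtain ⟨C, hC⟩ := hc.isBounded.exists_norm_le
  refine memLp_top_of_bound measurable_id.aestronglyMeasurable C ?_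
  filter_upwards [Measure.support_mem_ae (μ := μ)] with z hz using hC z hz

/-- The operator `M` of multiplication by the complex variable `z` on `L²(μ)`. -/
def mulZ (μ : Measure ℂ) (hc : IsCompact μ.support) : Lp ℂ 2 μ →L[ℂ] Lp ℂ 2 μ :=
  (ContinuousLinearMap.mul ℂ ℂ).holderL μ ∞ 2 2 (memLp_coord μ hc).toLp

theorem coeFn_mulZ (μ : Measure ℂ) (hc : IsCompact μ.support) (f : Lp ℂ 2 μ) :
    mulZ μ hc f =ᵐ[μ] fun z => z * f z := by
  have h1 := (ContinuousLinearMap.mul ℂ ℂ).coeFn_holder (r := 2) (memLp_coord μ hc).toLp f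
  filter_upwards [h1, (memLp_coord μ hc).coeFn_toLp] with z h1 h2
  refine h1.trans ?_
  rw [h2]
  rfl

/-- The elements of `L²(μ)` that are represented by complex polynomials in `z`. -/
def polyL2 (μ : Measure ℂ) : Submodule ℂ (Lp ℂ 2 μ) where
  carrier := {f | ∃ p : Polynomial ℂ, f =ᵐ[μ] fun z => p.eval z}
  zero_mem' := ⟨0, by
    filter_upwards [Lp.coeFn_zero ℂ 2 μ] with z hz
    refine hz.trans ?_
    simp⟩
  add_mem' := by
    rintro f g ⟨p, hp⟩ ⟨q, hq⟩
    refine ⟨p + q, ?_⟩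
    filter_upwards [hp, hq, Lp.coeFn_add f g] with z h1 h2 h3
    refine h3.trans ?_
    simp [h1, h2]
  smul_mem' := by
    rintro c f ⟨p, hp⟩
    refine ⟨c • p, ?_⟩
    filter_upwards [hp, Lp.coeFn_smul c f] with z h1 h2
    simp [h1, h2]

/-- `P²(μ)`, the closure of the polynomials in `L²(μ)`. -/
def P2 (μ : Measure ℂ) : Submodule ℂ (Lp ℂ 2 μ) :=
  (polyL2 μ).topologicalClosure

instance (μ : Measure ℂ) : CompleteSpace (P2 μ) :=
  (polyL2 μ).isClosed_topologicalClosure.completeSpace_coe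

/-- The orthogonal projection `P` of `L²(μ)` onto `P²(μ)`. -/
def projP (μ : Measure ℂ) : Lp ℂ 2 μ →L[ℂ] Lp ℂ 2 μ :=
  (P2 μ).starProjection

/-- The Hankel operator `[M*, P] = M* P - P M*`, as an operator on `L²(μ)`. -/
def hankel (μ : Measure ℂ) (hc : IsCompact μ.support) : Lp ℂ 2 μ →L[ℂ] Lp ℂ 2 μ :=
  ContinuousLinearMap.adjoint (mulZ μ hc) ∘L projP μ
    - projP μ ∘L ContinuousLinearMap.adjoint (mulZ μ hc)

end

/-!
Write `V = P²(μ)` and `T = [M*, P]`. As `M` maps `V` into itself, `M*` maps `Vᗮ` into itself, so `T`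
vanishes on `Vᗮ` and equals `(1 - P) M*` on `V`, with values in `Vᗮ`.

`T` is Hilbert-Schmidt by the argument of Berger and Shaw for cyclic operators. Let `e₀, e₁, …` be
the orthonormal polynomials of `μ`. Since `M` is normal, `‖T eⱼ‖² = ‖M eⱼ‖² - ‖P M* eⱼ‖²`. With
respect to `e`, multiplication by `z` is a Hessenberg matrix, `M eⱼ ∈ span {e₀, …, eⱼ₊₁}`, and in
the sum over `j ≤ n` everything cancels or is negative except for a contribution of `M eₙ`. So
`‖T‖²_HS ≤ ‖M‖²` (`sum_norm_sub_starProjection_adjoint_sq_le`, `hsNormSq_hankel_lt_top`).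

A Hilbert-Schmidt operator is compact. Hence the norm of `T` on `V`, and on the orthogonal
complement in `V` of finitely many vectors, is attained. Choosing maximizing unit vectors one after
the other gives an orthonormal sequence `fⱼ` of eigenvectors of `T* T` in `V`
(`exists_isSingularSystem`). By the minimax argument the successive maxima are the singular numbers
`κⱼ` (`IsSingularSystem.singularNumber_eq`). They tend to `0`, which gives the Schmidt expansion with
`gⱼ = κⱼ⁻¹ T fⱼ` (`IsSingularSystem.isSchmidtExpansion`).

Every Schmidt expansion yields `‖T R‖²_HS = ∑ κⱼ² ‖R* fⱼ‖²` for bounded `R`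
(`IsSchmidtExpansion.hsNormSq_comp`). For `R = 1 - Q` this is `∑ κⱼ² (1 - wⱼ)` with weights
`wⱼ = ‖Q fⱼ‖²` in `[0, 1]` of total at most the rank `d` of `Q`. As `κⱼ` decreases, such a sum is at
least `∑_{j ≥ d} κⱼ²` (`tsum_add_le_tsum_mul_of_antitone`). If `Q` projects onto the span of
`f₀, …, f_{d-1}`, then `wⱼ` is `1` for `j < d` and `0` otherwise, and equality holds.
-/

noncomputable section

/-! ### Hilbert-Schmidt operators -/

section HilbertSchmidt

variable {H : Type*} [NormedAddCommGroup H] [InnerProductSpace ℂ H]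

theorem mem_orthogonal_span_of_forall_inner_eq_zero {S : Set H} {x : H}
    (h : ∀ u ∈ S, ⟪u, x⟫_ℂ = 0) : x ∈ (Submodule.span ℂ S)ᗮ := by
  rw [Submodule.mem_orthogonal]
  intro u hu
  refine Submodule.span_induction h (by simp) ?_ ?_ hu
  · intro y z _ _ hy hz
    rw [inner_add_left, hy, hz, add_zero]
  · intro c y _ hy
    rw [inner_smul_left, hy, mul_zero]

theorem isCompactOperator_starProjection (W : Submodule ℂ H) [FiniteDimensional ℂ W] :
    IsCompactOperator W.starProjection := by
  have h := (isCompactOperator_id_iff_finiteDimensional (𝕜 := ℂ) (E := W)).2 inferInstance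
  exact (h.comp_clm W.orthogonalProjectionOnto).clm_comp W.subtypeL

variable [CompleteSpace H]

theorem Orthonormal.exists_hilbertBasis_extending_seq {e : ℕ → H} (he : Orthonormal ℂ e) :
    ∃ (w : Set H) (b : HilbertBasis w ℂ H) (j : ℕ → w),
      Function.Injective j ∧ ∀ n, b (j n) = e n := by
  obtain ⟨w, b, hw, hb⟩ := he.toSubtypeRange.exists_hilbertBasis_extension
  exact ⟨w, b, fun n => ⟨e n, hw ⟨n, rfl⟩⟩,
    fun m n h => he.linearIndependent.injective (congrArg Subtype.val h), fun n => by rw [hb]⟩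

theorem enorm_apply_sq_le_hsNormSq_mul (T : H →L[ℂ] H) (x : H) :
    ‖T x‖ₑ ^ 2 ≤ hsNormSq T * ‖x‖ₑ ^ 2 := by
  rw [parseval_enorm (stdBasis H) (T x), hsNormSq,
    tsum_enorm_adjoint (stdBasis H) (stdBasis H) T, ← ENNReal.tsum_mul_right]
  refine ENNReal.tsum_le_tsum fun i => ?_
  rw [← ContinuousLinearMap.adjoint_inner_right, ← mul_pow, mul_comm]
  gcongr
  rw [← ofReal_norm, ← ofReal_norm, ← ofReal_norm, ← ENNReal.ofReal_mul (norm_nonneg _)]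
  exact ENNReal.ofReal_le_ofReal (norm_inner_le_norm _ _)

theorem opNorm_le_sqrt_hsNormSq (T : H →L[ℂ] H) (hT : hsNormSq T ≠ ∞) :
    ‖T‖ ≤ Real.sqrt (hsNormSq T).toReal := by
  refine T.opNorm_le_bound (Real.sqrt_nonneg _) fun x => ?_
  refine abs_le_of_sq_le_sq' ?_ (by positivity) |>.2
  rw [mul_pow, Real.sq_sqrt ENNReal.toReal_nonneg]
  have h := ENNReal.toReal_mono (ENNReal.mul_ne_top hT (by simp))
    (enorm_apply_sq_le_hsNormSq_mul T x)
  simpa using h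

/-- A Hilbert-Schmidt operator is compact: it is the limit in norm of its compositions with the
projections onto the spans of finitely many basis vectors. -/
theorem isCompactOperator_of_hsNormSq_lt_top (T : H →L[ℂ] H) (hT : hsNormSq T < ∞) :
    IsCompactOperator T := by
  classical
  let b := stdBasis H
  let W : Finset (stdBasisSet H) → Submodule ℂ H := fun s => Submodule.span ℂ (b '' s)
  have hW : ∀ s, FiniteDimensional ℂ (W s) := fun s =>
    FiniteDimensional.span_of_finite ℂ (s.finite_toSet.image b)
  let F : Finset (stdBasisSet H) → H →L[ℂ] H := fun s => T ∘L (W s).starProjection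
  have hF : ∀ s, hsNormSq (T - F s) = ∑' i : { i // i ∉ s }, ‖T (b i)‖ₑ ^ 2 := by
    intro s
    rw [hsNormSq]
    have h1 : ∀ i, ‖(T - F s) (b i)‖ₑ ^ 2
        = Set.indicator {i | i ∉ s} (fun i => ‖T (b i)‖ₑ ^ 2) i := by
      intro i
      by_cases hi : i ∈ s
      · have : (W s).starProjection (b i) = b i :=
          Submodule.starProjection_eq_self_iff.2 (Submodule.subset_span ⟨i, hi, rfl⟩)
        simp [F, this, hi]
      · have : (W s).starProjection (b i) = 0 := by
          refine (Submodule.starProjection_apply_eq_zero_iff _).2 ?_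
          refine mem_orthogonal_span_of_forall_inner_eq_zero ?_
          rintro _ ⟨j, hj, rfl⟩
          exact b.orthonormal.2 (fun h => hi (h ▸ hj))
        simp [F, this, hi]
    exact (tsum_congr h1).trans (tsum_subtype _ _).symm
  have hlim : Tendsto F atTop (nhds T) := by
    rw [tendsto_iff_norm_sub_tendsto_zero]
    have h0 := ENNReal.tendsto_tsum_compl_atTop_zero (f := fun i => ‖T (b i)‖ₑ ^ 2) hT.ne
    have h1 : Tendsto (fun s => Real.sqrt (hsNormSq (T - F s)).toReal) atTop (nhds 0) := by
      simp_rw [hF]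
      have := (Real.continuous_sqrt.tendsto _).comp
        ((ENNReal.tendsto_toReal ENNReal.zero_ne_top).comp h0)
      rwa [ENNReal.toReal_zero, Real.sqrt_zero] at this
    refine squeeze_zero (fun s => norm_nonneg _) (fun s => ?_) h1
    rw [norm_sub_rev]
    refine opNorm_le_sqrt_hsNormSq _ ?_
    rw [hF]
    exact ((ENNReal.tsum_comp_le_tsum_of_injective Subtype.val_injective _).trans_lt hT).ne
  exact isCompactOperator_of_tendsto hlim
    (Eventually.of_forall fun s => (isCompactOperator_starProjection (W s)).clm_comp T)

/-- The Hilbert-Schmidt norm of an operator that vanishes on the orthogonal complement of an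
orthonormal sequence can be computed on that sequence alone. -/
theorem hsNormSq_eq_tsum_of_orthonormal (T : H →L[ℂ] H) (e : ℕ → H) (he : Orthonormal ℂ e)
    (hT : ∀ x, (∀ n, ⟪e n, x⟫_ℂ = 0) → T x = 0) :
    hsNormSq T = ∑' n, ‖T (e n)‖ₑ ^ 2 := by
  obtain ⟨w, b, j, hj, hbj⟩ := he.exists_hilbertBasis_extending_seq
  rw [hsNormSq_eq b T, ← hj.tsum_eq]
  · simp_rw [hbj]
  · intro i hi
    by_contra hne
    refine hi ?_
    have : T (b i) = 0 := hT _ fun n => by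
      rw [← hbj]
      exact b.orthonormal.2 fun h => hne ⟨n, h⟩
    simp [this]

/-- The expansion of `T x` along an orthonormal sequence whose orthogonal complement is killed by
`T`. -/
theorem hasSum_inner_smul_apply (T : H →L[ℂ] H) (e : ℕ → H) (he : Orthonormal ℂ e)
    (hT : ∀ x, (∀ n, ⟪e n, x⟫_ℂ = 0) → T x = 0) (x : H) :
    HasSum (fun n => ⟪e n, x⟫_ℂ • T (e n)) (T x) := by
  obtain ⟨w, b, j, hj, hbj⟩ := he.exists_hilbertBasis_extending_seq
  have h := T.hasSum (b.hasSum_repr x)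
  rw [← hj.hasSum_iff] at h
  · simpa [Function.comp_def, b.repr_apply_apply, hbj] using h
  · intro i hi
    have : T (b i) = 0 := hT _ fun n => by
      rw [← hbj]
      exact b.orthonormal.2 fun h => hi ⟨n, h⟩
    simp [this]

theorem tsum_enorm_apply_sq_le_hsNormSq (T : H →L[ℂ] H) {e : ℕ → H} (he : Orthonormal ℂ e) :
    ∑' n, ‖T (e n)‖ₑ ^ 2 ≤ hsNormSq T := by
  obtain ⟨w, b, j, hj, hbj⟩ := he.exists_hilbertBasis_extending_seq
  rw [hsNormSq_eq b T]
  simp_rw [← hbj]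
  exact ENNReal.tsum_comp_le_tsum_of_injective hj fun i => ‖T (b i)‖ₑ ^ 2

end HilbertSchmidt

/-! ### Singular vectors of a compact operator -/

section SingularVectors

variable {H : Type*} [NormedAddCommGroup H] [InnerProductSpace ℂ H] [CompleteSpace H]

/-- A compact operator attains its norm at a unit vector, which is an eigenvector of `T* T`. -/
theorem exists_unit_adjoint_apply_apply_eq {E : Type*} [NormedAddCommGroup E]
    [InnerProductSpace ℂ E] [CompleteSpace E] [Nontrivial E] (T : E →L[ℂ] H)
    (hT : IsCompactOperator T) :
    ∃ v : E, ‖v‖ = 1 ∧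
      (ContinuousLinearMap.adjoint T) (T v) = ((‖T‖ ^ 2 : ℝ) : ℂ) • v := by
  obtain ⟨u, hu⟩ := exists_ne (0 : E)
  suffices h : ∃ v : E, v ≠ 0 ∧
      (ContinuousLinearMap.adjoint T) (T v) = ((‖T‖ ^ 2 : ℝ) : ℂ) • v by
    obtain ⟨v, hv, hTv⟩ := h
    refine ⟨((‖v‖⁻¹ : ℝ) : ℂ) • v, ?_, ?_⟩
    · rw [norm_smul, Complex.norm_real, norm_inv, norm_norm,
        inv_mul_cancel₀ (norm_ne_zero_iff.2 hv)]
    · rw [map_smul, map_smul, hTv, smul_comm]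
  by_cases h0 : T = 0
  · exact ⟨u, hu, by simp [h0]⟩
  let A : E →L[ℂ] E := ContinuousLinearMap.adjoint T ∘L T
  have hA : IsCompactOperator A := hT.clm_comp (ContinuousLinearMap.adjoint T)
  have hnorm : ‖A‖ = ‖T‖ ^ 2 := by
    rw [sq]; exact ContinuousLinearMap.norm_adjoint_comp_self T
  have hpos : 0 < ‖A‖ := by
    rw [hnorm]; have := norm_pos_iff.2 h0; positivity
  have hsym : (A : E →ₗ[ℂ] E).IsSymmetric := fun x y => by
    simp [A, ContinuousLinearMap.adjoint_inner_left, ContinuousLinearMap.adjoint_inner_right]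
  have hq : ∀ x, 0 ≤ A.rayleighQuotient x := fun x => by
    rw [ContinuousLinearMap.rayleighQuotient, ContinuousLinearMap.reApplyInnerSelf_apply]
    simp only [A, ContinuousLinearMap.comp_apply, ContinuousLinearMap.adjoint_inner_left]
    exact div_nonneg inner_self_nonneg (by positivity)
  rcases hA.hasEigenvalue_or_mem_resolventSet (μ := (‖A‖ : ℂ))
    (Complex.ofReal_ne_zero.2 hpos.ne') with h | h
  · obtain ⟨v, hv⟩ := h.exists_hasEigenvector
    refine ⟨v, hv.2, ?_⟩
    have := hv.apply_eq_smul
    rw [hnorm] at this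
    exact this
  · -- the supremum `‖A‖` of the Rayleigh quotient would be smaller than itself
    obtain ⟨ε, hε, hle⟩ := A.rayleighQuotient_le_of_norm_mem_resolventSet h
    have h1 : ‖A‖ ≤ ‖A‖ - ε := by
      conv_lhs => rw [A.norm_eq_iSup_rayleighQuotient hsym]
      exact ciSup_le fun x => by rw [abs_of_nonneg (hq x)]; exact hle x
    linarith

/-- The norm of a compact operator `T` on the part of `V` orthogonal to a finite set is attained, at
a vector `v` that is there an eigenvector of the compression of `T* T`. -/
theorem exists_unit_maximizing_orthogonal_finite (V : Submodule ℂ H) (hVc : IsClosed (V : Set H))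
    (hV : ¬ FiniteDimensional ℂ V) (T : H →L[ℂ] H) (hT : IsCompactOperator T) (S : Set H)
    (hS : S.Finite) :
    ∃ v ∈ V ⊓ (Submodule.span ℂ S)ᗮ, ‖v‖ = 1 ∧ ∃ r : ℝ, 0 ≤ r ∧
      ∀ w ∈ V ⊓ (Submodule.span ℂ S)ᗮ, ‖T w‖ ≤ r * ‖w‖ ∧
        ⟪w, (ContinuousLinearMap.adjoint T) (T v)⟫_ℂ = ((r ^ 2 : ℝ) : ℂ) * ⟪w, v⟫_ℂ := by
  have hfin : FiniteDimensional ℂ (Submodule.span ℂ S) := FiniteDimensional.span_of_finite ℂ hS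
  set W : Submodule ℂ H := V ⊓ (Submodule.span ℂ S)ᗮ with hW
  have hWc : IsClosed (W : Set H) := hVc.inter (Submodule.isClosed_orthogonal _)
  have : CompleteSpace W := hWc.completeSpace_coe
  have hne : Nontrivial W := by
    refine Submodule.nontrivial_iff_ne_bot.2 fun hbot => hV ?_
    -- otherwise the projection onto the span of `S` would be injective on `V`
    refine FiniteDimensional.of_injective
      (((Submodule.span ℂ S).orthogonalProjectionOnto : H →ₗ[ℂ] Submodule.span ℂ S) ∘ₗ V.subtype) ?_
    rw [injective_iff_map_eq_zero]
    rintro ⟨x, hx⟩ h0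
    have hx' : x ∈ W := by
      refine ⟨hx, (Submodule.starProjection_apply_eq_zero_iff _).1 ?_⟩
      rw [Submodule.starProjection_apply]
      exact congrArg Subtype.val h0
    rw [hbot, Submodule.mem_bot] at hx'
    exact Subtype.ext hx'
  let TW : W →L[ℂ] H := T ∘L W.subtypeL
  obtain ⟨v, hv, hTv⟩ := exists_unit_adjoint_apply_apply_eq TW (hT.comp_clm W.subtypeL)
  refine ⟨v, v.2, hv, ‖TW‖, TW.opNorm_nonneg, fun w hw => ⟨TW.le_opNorm ⟨w, hw⟩, ?_⟩⟩
  have h := congrArg (fun y => ⟪(⟨w, hw⟩ : W), y⟫_ℂ) hTv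
  simp only [ContinuousLinearMap.adjoint_inner_right, inner_smul_right] at h
  rw [ContinuousLinearMap.adjoint_inner_right]
  exact h

/-- The sequence whose `n`-th term is chosen by `next` from the set of the previous terms. -/
def greedySeq (next : Set H → H) (n : ℕ) : H :=
  next (Set.range fun i : Fin n => greedySeq next i)
termination_by n
decreasing_by exact i.2

/-- `f` is an orthonormal sequence in `V` of eigenvectors of `T* T`, with eigenvalues `sₙ²`, and `sₙ`
is the norm of `T` on the orthogonal complement of the first `n` vectors. -/
structure IsSingularSystem (V : Submodule ℂ H) (T : H →L[ℂ] H) (f : ℕ → H) (s : ℕ → ℝ) : Prop where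
  orthonormal : Orthonormal ℂ f
  mem : ∀ n, f n ∈ V
  nonneg : ∀ n, 0 ≤ s n
  eigen : ∀ n, (ContinuousLinearMap.adjoint T) (T (f n)) = ((s n ^ 2 : ℝ) : ℂ) • f n
  norm_le : ∀ n x, (∀ i < n, ⟪f i, x⟫_ℂ = 0) → ‖T x‖ ≤ s n * ‖x‖

/-- A compact operator that vanishes on `Vᗮ` has a singular system in `V`: the next vector
maximizes `‖T v‖` among the unit vectors of `V` orthogonal to the previous ones. -/
theorem exists_isSingularSystem (V : Submodule ℂ H) (hVc : IsClosed (V : Set H))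
    (hV : ¬ FiniteDimensional ℂ V) (T : H →L[ℂ] H) (hT : IsCompactOperator T)
    (hTV : ∀ x ∈ Vᗮ, T x = 0) : ∃ f s, IsSingularSystem V T f s := by
  have : CompleteSpace V := hVc.completeSpace_coe
  choose! next hmem hnorm r hr hmax using exists_unit_maximizing_orthogonal_finite V hVc hV T hT
  let f : ℕ → H := greedySeq next
  let S : ℕ → Set H := fun n => Set.range fun i : Fin n => f i
  have hS : ∀ n, (S n).Finite := fun n => Set.finite_range _
  have hf : ∀ n, f n = next (S n) := fun n => by
    change greedySeq next n = _
    rw [greedySeq]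
  have hperp : ∀ n x, (∀ i < n, ⟪f i, x⟫_ℂ = 0) → x ∈ (Submodule.span ℂ (S n))ᗮ := by
    intro n x hx
    refine mem_orthogonal_span_of_forall_inner_eq_zero ?_
    rintro _ ⟨i, rfl⟩
    exact hx i i.2
  have hlt : ∀ i n, i < n → ⟪f i, f n⟫_ℂ = 0 := by
    intro i n hin
    have h := (hmem (S n) (hS n)).2
    rw [← hf] at h
    exact (Submodule.mem_orthogonal _ _).1 h _ (Submodule.subset_span ⟨⟨i, hin⟩, rfl⟩)
  have hortho : Orthonormal ℂ f := by
    refine ⟨fun n => by rw [hf]; exact hnorm _ (hS n), fun i j hij => ?_⟩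
    rcases lt_or_gt_of_ne hij with h | h
    · exact hlt i j h
    · exact inner_eq_zero_symm.1 (hlt j i h)
  have hfV : ∀ n, f n ∈ V := fun n => by rw [hf]; exact (hmem _ (hS n)).1
  -- the range of `T*` is orthogonal to the kernel of `T`, which contains `Vᗮ`
  have hAV : ∀ x, (ContinuousLinearMap.adjoint T) x ∈ V := by
    intro x
    rw [← hVc.submodule_topologicalClosure_eq, ← Submodule.orthogonal_orthogonal_eq_closure,
      Submodule.mem_orthogonal]
    intro u hu
    rw [ContinuousLinearMap.adjoint_inner_right, hTV u hu, inner_zero_left]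
  have heigen : ∀ n, (ContinuousLinearMap.adjoint T) (T (f n))
      = ((r (S n) ^ 2 : ℝ) : ℂ) • f n := by
    intro n
    induction n using Nat.strong_induction_on with
    | _ n ih =>
      -- the difference of the two sides lies in the space on which `f n` is an eigenvector
      have hd : (ContinuousLinearMap.adjoint T) (T (f n)) - ((r (S n) ^ 2 : ℝ) : ℂ) • f n
          ∈ V ⊓ (Submodule.span ℂ (S n))ᗮ := by
        refine ⟨V.sub_mem (hAV _) (V.smul_mem _ (hfV n)), hperp n _ fun i hi => ?_⟩
        rw [inner_sub_right, inner_smul_right, ContinuousLinearMap.adjoint_inner_right,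
          ← ContinuousLinearMap.adjoint_inner_left, ih i hi, inner_smul_left, hlt i n hi]
        simp
      have h := (hmax (S n) (hS n) _ hd).2
      rw [← hf] at h
      rw [← sub_eq_zero, ← inner_self_eq_zero (𝕜 := ℂ)]
      conv_lhs => rw [inner_sub_right, inner_smul_right, h, sub_self]
  refine ⟨f, fun n => r (S n), hortho, hfV, fun n => hr _ (hS n), heigen, fun n x hx => ?_⟩
  have hsub := V.sub_starProjection_mem_orthogonal x
  have hTx : T x = T (V.starProjection x) := by
    rw [← sub_eq_zero, ← map_sub, hTV _ hsub]
  have hp : V.starProjection x ∈ V ⊓ (Submodule.span ℂ (S n))ᗮ := by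
    refine ⟨V.starProjection_apply_mem x, hperp n _ fun i hi => ?_⟩
    rw [← Submodule.inner_starProjection_left_eq_right,
      Submodule.starProjection_eq_self_iff.2 (hfV i), hx i hi]
  rw [hTx]
  exact ((hmax _ (hS n) _ hp).1).trans
    (mul_le_mul_of_nonneg_left (V.norm_starProjection_apply_le x) (hr _ (hS n)))

namespace IsSingularSystem

variable {V : Submodule ℂ H} {T : H →L[ℂ] H} {f : ℕ → H} {s : ℕ → ℝ}

theorem inner_apply_apply (h : IsSingularSystem V T f s) (i j : ℕ) :
    ⟪T (f i), T (f j)⟫_ℂ = if i = j then ((s j ^ 2 : ℝ) : ℂ) else 0 := by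
  rw [← ContinuousLinearMap.adjoint_inner_right, h.eigen, inner_smul_right,
    orthonormal_iff_ite.1 h.orthonormal]
  split_ifs <;> simp

theorem norm_apply (h : IsSingularSystem V T f s) (n : ℕ) : ‖T (f n)‖ = s n := by
  have h1 := h.inner_apply_apply n n
  rw [if_pos rfl, inner_self_eq_norm_sq_to_K] at h1
  have h2 : ‖T (f n)‖ ^ 2 = s n ^ 2 := Complex.ofReal_injective (by push_cast at h1 ⊢; exact h1)
  exact (sq_eq_sq₀ (norm_nonneg _) (h.nonneg n)).1 h2

theorem antitone (h : IsSingularSystem V T f s) : Antitone s := by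
  refine antitone_nat_of_succ_le fun n => ?_
  have h1 := h.norm_le n (f (n + 1)) fun i hi => h.orthonormal.2 (by omega)
  rwa [h.norm_apply, h.orthonormal.1, mul_one] at h1

/-- The numbers of a singular system are the singular numbers: for orthonormal eigenvectors
`v₀, …, vⱼ` some unit vector in their span is orthogonal to `f₀, …, fⱼ₋₁`. -/
theorem singularNumber_eq (h : IsSingularSystem V T f s) (j : ℕ) : singularNumber T j = s j := by
  refine IsGreatest.csSup_eq ⟨⟨h.nonneg j, fun i => f i, fun i => s i, ?_, fun i => ⟨?_, ?_⟩⟩, ?_⟩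
  · exact h.orthonormal.comp _ Fin.val_injective
  · exact h.antitone (by omega)
  · exact h.eigen i
  · rintro t ⟨ht, v, σ, hv, hσ⟩
    -- `j + 1` coefficients, subject to `j` linear conditions
    obtain ⟨c, hc0, hc⟩ : ∃ c : Fin (j + 1) → ℂ, c ≠ 0 ∧
        ∀ i < j, ⟪f i, ∑ k, c k • v k⟫_ℂ = 0 := by
      let L : (Fin (j + 1) → ℂ) →ₗ[ℂ] (Fin j → ℂ) :=
        { toFun := fun c i => ⟪f i, ∑ k, c k • v k⟫_ℂ
          map_add' := fun c c' => by
            ext i; simp [add_smul, Finset.sum_add_distrib]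
          map_smul' := fun a c => by
            ext i; simp [mul_smul, ← Finset.smul_sum] }
      have hker : LinearMap.ker L ≠ ⊥ := LinearMap.ker_ne_bot_of_finrank_lt (by simp)
      obtain ⟨c, hc, hc0⟩ := Submodule.exists_mem_ne_zero_of_ne_bot hker
      exact ⟨c, hc0, fun i hi => congrFun (LinearMap.mem_ker.1 hc) ⟨i, hi⟩⟩
    set x := ∑ k, c k • v k with hx
    have hxx : ‖x‖ ^ 2 = ∑ k, ‖c k‖ ^ 2 := by
      have h1 : ⟪x, x⟫_ℂ = ∑ k, (starRingEnd ℂ) (c k) * c k := hv.inner_sum c c _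
      rw [inner_self_eq_norm_sq_to_K] at h1
      have h2 : ((‖x‖ ^ 2 : ℝ) : ℂ) = ((∑ k, ‖c k‖ ^ 2 : ℝ) : ℂ) := by
        push_cast
        refine h1.trans (Finset.sum_congr rfl fun k _ => ?_)
        rw [Complex.conj_mul']
      exact_mod_cast h2
    have hTx : ‖T x‖ ^ 2 = ∑ k, ‖c k‖ ^ 2 * σ k ^ 2 := by
      have h1 : ⟪x, (ContinuousLinearMap.adjoint T) (T x)⟫_ℂ
          = ∑ k, (starRingEnd ℂ) (c k) * (c k * ((σ k ^ 2 : ℝ) : ℂ)) := by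
        rw [← hv.inner_sum c (fun k => c k * ((σ k ^ 2 : ℝ) : ℂ)) Finset.univ]
        simp only [hx, map_sum, map_smul, (hσ _).2, smul_smul]
      rw [ContinuousLinearMap.adjoint_inner_right, inner_self_eq_norm_sq_to_K] at h1
      have h2 : ((‖T x‖ ^ 2 : ℝ) : ℂ) = ((∑ k, ‖c k‖ ^ 2 * σ k ^ 2 : ℝ) : ℂ) := by
        push_cast at h1 ⊢
        refine h1.trans (Finset.sum_congr rfl fun k _ => ?_)
        rw [← mul_assoc, Complex.conj_mul']
      exact_mod_cast h2
    have hxpos : 0 < ‖x‖ ^ 2 := by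
      obtain ⟨k, hk⟩ := Function.ne_iff.1 hc0
      have hk' : c k ≠ 0 := hk
      rw [hxx]
      exact Finset.sum_pos' (fun _ _ => by positivity) ⟨k, Finset.mem_univ k, by positivity⟩
    have h1 : t ^ 2 * ‖x‖ ^ 2 ≤ ‖T x‖ ^ 2 := by
      rw [hTx, hxx, Finset.mul_sum]
      refine Finset.sum_le_sum fun k _ => ?_
      rw [mul_comm]
      have := (hσ k).1
      gcongr
    have h2 : ‖T x‖ ^ 2 ≤ s j ^ 2 * ‖x‖ ^ 2 := by
      rw [← mul_pow]
      exact pow_le_pow_left₀ (norm_nonneg _) (h.norm_le j x hc) 2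
    exact (sq_le_sq₀ ht (h.nonneg j)).1 (le_of_mul_le_mul_right (h1.trans h2) hxpos)

end IsSingularSystem

end SingularVectors

/-! ### Schmidt expansions -/

section SchmidtExpansion

variable {H : Type*} [NormedAddCommGroup H] [InnerProductSpace ℂ H]

/-- A projection of rank `d` takes at most the total weight `d` on an orthonormal sequence. -/
theorem tsum_enorm_starProjection_sq_le (W : Submodule ℂ H) [FiniteDimensional ℂ W] {f : ℕ → H}
    (hf : Orthonormal ℂ f) :
    ∑' j, ‖W.starProjection (f j)‖ₑ ^ 2 ≤ Module.finrank ℂ W := by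
  let q := stdOrthonormalBasis ℂ W
  have h1 : ∀ x, ‖W.starProjection x‖ₑ ^ 2 = ∑ i, ‖⟪x, (q i : H)⟫_ℂ‖ₑ ^ 2 := by
    intro x
    have h2 := q.sum_sq_norm_inner_left (W.orthogonalProjectionOnto x)
    have h3 : ‖W.starProjection x‖ ^ 2 = ∑ i, ‖⟪x, (q i : H)⟫_ℂ‖ ^ 2 := by
      rw [Submodule.starProjection_apply]
      refine h2.symm.trans ?_
      refine Finset.sum_congr rfl fun i _ => ?_
      rw [Submodule.coe_inner, ← Submodule.starProjection_apply,
        Submodule.inner_starProjection_left_eq_right, Submodule.starProjection_mem_subspace_eq_self]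
    simp_rw [← ofReal_norm, ← ENNReal.ofReal_pow (norm_nonneg _)]
    rw [h3, ENNReal.ofReal_sum_of_nonneg fun _ _ => by positivity]
  simp_rw [h1]
  rw [Summable.tsum_finsetSum fun _ _ => ENNReal.summable]
  have h2 : ∀ i, ∑' j, ‖⟪f j, (q i : H)⟫_ℂ‖ₑ ^ 2 ≤ 1 := by
    intro i
    have h3 : ∑' j, ‖⟪f j, (q i : H)⟫_ℂ‖ ^ 2 ≤ ‖(q i : H)‖ ^ 2 := hf.tsum_inner_products_le _
    have h4 : ‖(q i : H)‖ = 1 := q.orthonormal.1 i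
    rw [h4, one_pow] at h3
    simp_rw [← ofReal_norm, ← ENNReal.ofReal_pow (norm_nonneg _)]
    rw [← ENNReal.ofReal_tsum_of_nonneg (fun _ => by positivity) (hf.inner_products_summable _)]
    exact ENNReal.ofReal_le_one.2 h3
  refine (Finset.sum_le_sum fun i _ => h2 i).trans ?_
  simp

variable [CompleteSpace H]

/-- A singular system of a Hilbert-Schmidt operator `T : V → Vᗮ` gives a Schmidt expansion, with
`gⱼ = sⱼ⁻¹ T fⱼ`. The numbers `sⱼ` tend to `0`, so `T` vanishes on the orthogonal complement of all
`fⱼ`. -/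
theorem IsSingularSystem.isSchmidtExpansion {V : Submodule ℂ H} {T : H →L[ℂ] H} {f : ℕ → H}
    {s : ℕ → ℝ} (h : IsSingularSystem V T f s) (hT : hsNormSq T < ∞) (hTV : ∀ x, T x ∈ Vᗮ) :
    IsSchmidtExpansion V T f fun j => ((s j)⁻¹ : ℂ) • T (f j) := by
  have hs : singularNumber T = s := funext h.singularNumber_eq
  have hlim : Tendsto s atTop (nhds 0) := by
    have h1 := ENNReal.tendsto_atTop_zero_of_tsum_ne_top
      ((tsum_enorm_apply_sq_le_hsNormSq T h.orthonormal).trans_lt hT).ne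
    have h2 := (Real.continuous_sqrt.tendsto _).comp
      ((ENNReal.tendsto_toReal ENNReal.zero_ne_top).comp h1)
    rw [ENNReal.toReal_zero, Real.sqrt_zero] at h2
    refine h2.congr fun n => ?_
    simp [h.norm_apply, Real.sqrt_sq (h.nonneg n)]
  have hzero : ∀ x, (∀ n, ⟪f n, x⟫_ℂ = 0) → T x = 0 := by
    intro x hx
    have h1 : Tendsto (fun n => s n * ‖x‖) atTop (nhds 0) := by simpa using hlim.mul_const ‖x‖
    exact norm_le_zero_iff.1
      (ge_of_tendsto h1 (Eventually.of_forall fun n => h.norm_le n x fun i _ => hx i))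
  refine ⟨h.orthonormal, h.mem, ?_, fun j => Submodule.smul_mem _ _ (hTV _), fun x => ?_⟩
  · rw [orthonormal_iff_ite]
    rintro ⟨i, hi⟩ ⟨j, hj⟩
    rw [hs] at hi hj
    simp only [inner_smul_left, inner_smul_right, h.inner_apply_apply, Subtype.mk.injEq]
    split_ifs with hij
    · subst hij
      have : (s i : ℂ) ≠ 0 := Complex.ofReal_ne_zero.2 hi
      simp only [map_inv₀, Complex.conj_ofReal]
      push_cast
      field_simp
    · simp
  · refine (hasSum_inner_smul_apply T f h.orthonormal hzero x).congr_fun fun j => ?_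
    rw [hs]
    by_cases hj : s j = 0
    · have : T (f j) = 0 := by rw [← norm_eq_zero, h.norm_apply, hj]
      simp [this]
    · have : (s j : ℂ) ≠ 0 := Complex.ofReal_ne_zero.2 hj
      simp only [smul_smul]
      congr 1
      field_simp

namespace IsSchmidtExpansion

variable {V : Submodule ℂ H} {T : H →L[ℂ] H} {f g : ℕ → H}

theorem enorm_apply_sq (h : IsSchmidtExpansion V T f g) (x : H) :
    ‖T x‖ₑ ^ 2 = ∑' j, ENNReal.ofReal (singularNumber T j ^ 2) * ‖⟪f j, x⟫_ℂ‖ₑ ^ 2 := by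
  set κ := singularNumber T
  let a : ℕ → ℂ := fun j => (κ j : ℂ) * ⟪f j, x⟫_ℂ
  have hexp : HasSum (fun j => a j • g j) (T x) := by
    simpa only [smul_smul] using h.expansion x
  -- only the `g j` with `κ j ≠ 0` are known to be orthonormal, but the other terms vanish
  have hg : ∀ i j, ⟪a i • g i, a j • g j⟫_ℂ = if i = j then ((‖a j‖ ^ 2 : ℝ) : ℂ) else 0 := by
    intro i j
    by_cases hi : κ i = 0
    · split_ifs with hij
      · subst hij; simp [a, hi]
      · simp [a, hi]
    by_cases hj : κ j = 0
    · simp [a, hj]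
    have h1 := orthonormal_iff_ite.1 h.orthonormal_g ⟨i, hi⟩ ⟨j, hj⟩
    simp only [Subtype.mk.injEq] at h1
    rw [inner_smul_left, inner_smul_right, h1]
    split_ifs with hij
    · subst hij
      rw [mul_one, Complex.conj_mul']
      push_cast
      rfl
    · simp
  have hcoeff : ∀ j, ⟪T x, a j • g j⟫_ℂ = ((‖a j‖ ^ 2 : ℝ) : ℂ) := by
    intro j
    rw [← inner_conj_symm]
    have h1 := (innerSL ℂ (a j • g j)).hasSum hexp
    have h2 := hasSum_ite_eq j ((‖a j‖ ^ 2 : ℝ) : ℂ)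
    have h3 : ⟪a j • g j, T x⟫_ℂ = ((‖a j‖ ^ 2 : ℝ) : ℂ) := by
      refine HasSum.unique h1 (h2.congr_fun fun i => ?_)
      simp only [innerSL_apply_apply, hg]
      by_cases hij : i = j
      · subst hij; simp
      · simp [hij, Ne.symm hij]
    rw [h3, Complex.conj_ofReal]
  have hsum : HasSum (fun j => ‖a j‖ ^ 2) (‖T x‖ ^ 2) := by
    have h1 := (innerSL ℂ (T x)).hasSum hexp
    rw [← Complex.hasSum_ofReal]
    have h2 : (innerSL ℂ (T x)) (T x) = ((‖T x‖ ^ 2 : ℝ) : ℂ) := by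
      rw [innerSL_apply_apply, inner_self_eq_norm_sq_to_K]
      push_cast
      rfl
    rw [h2] at h1
    exact h1.congr_fun fun j => (hcoeff j).symm
  rw [← ofReal_norm, ← ENNReal.ofReal_pow (norm_nonneg _), ← hsum.tsum_eq,
    ENNReal.ofReal_tsum_of_nonneg (fun i => by positivity) hsum.summable]
  refine tsum_congr fun j => ?_
  rw [← ofReal_norm, ← ENNReal.ofReal_pow (norm_nonneg _), ← ENNReal.ofReal_mul (by positivity)]
  simp only [a, norm_mul, mul_pow, Complex.norm_real, Real.norm_eq_abs, sq_abs]

/-- `‖T R‖²_HS = ∑ κⱼ² ‖R* fⱼ‖²`. -/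
theorem hsNormSq_comp (h : IsSchmidtExpansion V T f g) (R : H →L[ℂ] H) :
    hsNormSq (T ∘L R) = ∑' j, ENNReal.ofReal (singularNumber T j ^ 2) *
      ‖(ContinuousLinearMap.adjoint R) (f j)‖ₑ ^ 2 := by
  rw [hsNormSq]
  simp_rw [ContinuousLinearMap.comp_apply, h.enorm_apply_sq]
  rw [ENNReal.tsum_comm]
  refine tsum_congr fun j => ?_
  rw [ENNReal.tsum_mul_left, parseval_enorm (stdBasis H)]
  simp_rw [ContinuousLinearMap.adjoint_inner_left]

end IsSchmidtExpansion

theorem enorm_apply_sq_add_enorm_id_sub_apply_sq {Q : H →L[ℂ] H} (hQ : IsStarProjection Q) (x : H) :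
    ‖(ContinuousLinearMap.id ℂ H - Q) x‖ₑ ^ 2 + ‖Q x‖ₑ ^ 2 = ‖x‖ₑ ^ 2 := by
  have hQQ : Q (Q x) = Q x := congrArg (fun A : H →L[ℂ] H => A x) hQ.isIdempotentElem
  have hsymm := hQ.isSelfAdjoint.isSymmetric (Q x) x
  simp only [ContinuousLinearMap.coe_coe, hQQ] at hsymm
  have h0 : ⟪Q x, x - Q x⟫_ℂ = 0 := by
    have h1 := hQ.isSelfAdjoint.isSymmetric x (Q x)
    simp only [ContinuousLinearMap.coe_coe, hQQ] at h1
    rw [inner_sub_right, hsymm, sub_self]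
  have h := norm_add_sq_eq_norm_sq_add_norm_sq_of_inner_eq_zero _ _ h0
  rw [add_sub_cancel] at h
  have h' : ‖x - Q x‖ ^ 2 + ‖Q x‖ ^ 2 = ‖x‖ ^ 2 := by nlinarith
  simp only [sub_apply, ContinuousLinearMap.id_apply]
  rw [← ofReal_norm, ← ofReal_norm, ← ofReal_norm, ← ENNReal.ofReal_pow (norm_nonneg _),
    ← ENNReal.ofReal_pow (norm_nonneg _), ← ENNReal.ofReal_pow (norm_nonneg _),
    ← ENNReal.ofReal_add (by positivity) (by positivity), h']

/-- If `u j + w j = 1` and the total weight of `w` is at most `d`, then `∑ aⱼ uⱼ` is smallest when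
`w` sits on the `d` largest terms of the decreasing sequence `a`. -/
theorem tsum_add_le_tsum_mul_of_antitone {a u w : ℕ → ℝ≥0∞} (ha : Antitone a)
    (huw : ∀ j, u j + w j = 1) (d : ℕ) (hw : ∑' j, w j ≤ d) :
    ∑' k, a (d + k) ≤ ∑' j, a j * u j := by
  have hsplit : ∀ c : ℕ → ℝ≥0∞, ∑' j, c j = ∑ j ∈ Finset.range d, c j + ∑' k, c (d + k) := by
    intro c
    rw [← Summable.sum_add_tsum_nat_add' (k := d) ENNReal.summable]
    simp_rw [add_comm d]
  have hle : ∀ j, w j ≤ 1 := fun j => by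
    rw [← huw j]
    exact le_add_self
  have htail : ∑' k, w (d + k) ≤ ∑ j ∈ Finset.range d, u j := by
    have hfin : ∑ j ∈ Finset.range d, w j ≠ ∞ :=
      (ENNReal.sum_lt_top.2 fun j _ => (hle j).trans_lt ENNReal.one_lt_top).ne
    rw [← ENNReal.add_le_add_iff_left hfin, ← hsplit w, ← Finset.sum_add_distrib]
    refine hw.trans (le_of_eq ?_)
    simp_rw [add_comm (w _), huw]
    simp
  calc ∑' k, a (d + k)
      = ∑' k, a (d + k) * w (d + k) + ∑' k, a (d + k) * u (d + k) := by
        rw [← ENNReal.tsum_add]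
        refine tsum_congr fun k => ?_
        rw [← mul_add, add_comm (w _), huw, mul_one]
    _ ≤ ∑ j ∈ Finset.range d, a j * u j + ∑' k, a (d + k) * u (d + k) := by
        gcongr
        calc ∑' k, a (d + k) * w (d + k) ≤ ∑' k, a d * w (d + k) :=
              ENNReal.tsum_le_tsum fun k => mul_le_mul_left (ha (Nat.le_add_right d k)) _
          _ = a d * ∑' k, w (d + k) := ENNReal.tsum_mul_left
          _ ≤ a d * ∑ j ∈ Finset.range d, u j := by gcongr
          _ = ∑ j ∈ Finset.range d, a d * u j := Finset.mul_sum _ _ _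
          _ ≤ ∑ j ∈ Finset.range d, a j * u j :=
              Finset.sum_le_sum fun j hj =>
                mul_le_mul_left (ha (Finset.mem_range.1 hj).le) _
    _ = ∑' j, a j * u j := (hsplit fun j => a j * u j).symm

namespace IsSchmidtExpansion

variable {V : Submodule ℂ H} {T : H →L[ℂ] H} {f g : ℕ → H}

theorem tsum_singularNumber_sq_le (h : IsSchmidtExpansion V T f g)
    (hanti : Antitone (singularNumber T)) (hnonneg : ∀ j, 0 ≤ singularNumber T j)
    {Q : H →L[ℂ] H} (hQ : IsStarProjection Q) [FiniteDimensional ℂ Q.range] :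
    ∑' j, ENNReal.ofReal (singularNumber T (Module.finrank ℂ Q.range + j) ^ 2)
      ≤ hsNormSq (T ∘L (ContinuousLinearMap.id ℂ H - Q)) := by
  have hadj : ContinuousLinearMap.adjoint (ContinuousLinearMap.id ℂ H - Q)
      = ContinuousLinearMap.id ℂ H - Q := hQ.one_sub.isSelfAdjoint
  rw [h.hsNormSq_comp, hadj]
  refine tsum_add_le_tsum_mul_of_antitone (w := fun j => ‖Q (f j)‖ₑ ^ 2)
    (a := fun j => ENNReal.ofReal (singularNumber T j ^ 2))
    (fun i j hij => ENNReal.ofReal_le_ofReal (pow_le_pow_left₀ (hnonneg j) (hanti hij) 2))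
    (fun j => ?_) _ ?_
  · rw [enorm_apply_sq_add_enorm_id_sub_apply_sq hQ, ← ofReal_norm, h.orthonormal_f.1]
    simp
  · obtain ⟨_, hQ'⟩ := isStarProjection_iff_eq_starProjection_range.1 hQ
    have := tsum_enorm_starProjection_sq_le Q.range h.orthonormal_f
    rwa [← hQ'] at this

theorem hsNormSq_comp_id_sub_eq (h : IsSchmidtExpansion V T f g) (d : ℕ)
    {Q : H →L[ℂ] H} (hQ : IsStarProjection Q)
    (hrange : Q.range = Submodule.span ℂ (f '' Set.Iio d)) :
    hsNormSq (T ∘L (ContinuousLinearMap.id ℂ H - Q))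
      = ∑' j, ENNReal.ofReal (singularNumber T (d + j) ^ 2) := by
  have hadj : ContinuousLinearMap.adjoint (ContinuousLinearMap.id ℂ H - Q)
      = ContinuousLinearMap.id ℂ H - Q := hQ.one_sub.isSelfAdjoint
  have hlow : ∀ j < d, Q (f j) = f j := by
    intro j hj
    have hmem : f j ∈ Q.range := hrange ▸ Submodule.subset_span ⟨j, hj, rfl⟩
    obtain ⟨y, hy⟩ := hmem
    rw [← hy]
    exact congrArg (fun A : H →L[ℂ] H => A y) hQ.isIdempotentElem
  have hhigh : ∀ j, d ≤ j → Q (f j) = 0 := by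
    intro j hj
    have hperp : f j ∈ Q.rangeᗮ := by
      rw [hrange]
      refine mem_orthogonal_span_of_forall_inner_eq_zero ?_
      rintro _ ⟨i, hi, rfl⟩
      exact h.orthonormal_f.2 (lt_of_lt_of_le hi hj).ne
    rw [← inner_self_eq_zero (𝕜 := ℂ)]
    have h1 := hQ.isSelfAdjoint.isSymmetric (f j) (Q (f j))
    exact h1.trans
      (Submodule.inner_left_of_mem_orthogonal (K := Q.range) (LinearMap.mem_range_self _ _) hperp)
  rw [h.hsNormSq_comp, hadj, ← Summable.sum_add_tsum_nat_add' (k := d) ENNReal.summable,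
    Finset.sum_eq_zero, zero_add]
  · refine tsum_congr fun k => ?_
    have : ‖f (d + k)‖ₑ = 1 := by rw [← ofReal_norm, h.orthonormal_f.1]; simp
    rw [add_comm k d]
    simp [hhigh (d + k) (Nat.le_add_right d k), this]
  · intro j hj
    simp [hlow j (Finset.mem_range.1 hj)]

end IsSchmidtExpansion

end SchmidtExpansion

/-! ### The self-commutator estimate -/

section SelfCommutator

variable {H : Type*} [NormedAddCommGroup H] [InnerProductSpace ℂ H]

/-- Bessel's inequality is an equality on the span of the orthonormal vectors. -/
theorem Orthonormal.sum_norm_inner_sq_eq_of_mem_span {ι : Type*} {e : ι → H}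
    (he : Orthonormal ℂ e) (s : Finset ι) {x : H} (hx : x ∈ Submodule.span ℂ (e '' s)) :
    ∑ j ∈ s, ‖⟪e j, x⟫_ℂ‖ ^ 2 = ‖x‖ ^ 2 := by
  obtain ⟨c, rfl⟩ := (Submodule.mem_span_image_finset_iff_exists_fun ℂ).1 hx
  have he' : Orthonormal ℂ fun j : s => e j := he.comp _ Subtype.val_injective
  have h1 : ⟪∑ j : s, c j • e j, ∑ j : s, c j • e j⟫_ℂ = ∑ j : s, (starRingEnd ℂ) (c j) * c j :=
    he'.inner_sum c c Finset.univ
  rw [inner_self_eq_norm_sq_to_K] at h1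
  rw [← Finset.sum_coe_sort s]
  refine Complex.ofReal_injective ?_
  push_cast at h1 ⊢
  refine Eq.trans (Finset.sum_congr rfl fun j _ => ?_) h1.symm
  rw [he'.inner_right_fintype c j, Complex.conj_mul']

variable [CompleteSpace H]

/-- The basic estimate behind the Berger-Shaw theorem. Let `M` be normal and let `e` be an
orthonormal sequence in `V` with respect to which `M` is a Hessenberg matrix. In the partial trace
of the self-commutator of `M` on `V` all matrix entries cancel or are negative, except those of the
last column. -/
theorem sum_norm_sub_starProjection_adjoint_sq_le (V : Submodule ℂ H) [V.HasOrthogonalProjection]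
    (M : H →L[ℂ] H) (hM : ∀ x, ‖(ContinuousLinearMap.adjoint M) x‖ = ‖M x‖) {e : ℕ → H}
    (he : Orthonormal ℂ e) (heV : ∀ n, e n ∈ V)
    (hMe : ∀ n, M (e n) ∈ Submodule.span ℂ (e '' Set.Iic (n + 1))) (n : ℕ) :
    ∑ j ∈ Finset.range n, ‖(ContinuousLinearMap.adjoint M) (e j)
      - V.starProjection ((ContinuousLinearMap.adjoint M) (e j))‖ ^ 2 ≤ ‖M‖ ^ 2 := by
  rcases n with _ | n
  · simp
  have h1 : ∀ j, ‖(ContinuousLinearMap.adjoint M) (e j)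
      - V.starProjection ((ContinuousLinearMap.adjoint M) (e j))‖ ^ 2
      ≤ ‖M (e j)‖ ^ 2 - ∑ i ∈ Finset.range (n + 1), ‖⟪e j, M (e i)⟫_ℂ‖ ^ 2 := by
    intro j
    set y := (ContinuousLinearMap.adjoint M) (e j) with hy
    have h2 := V.norm_sq_eq_add_norm_sq_starProjection y
    rw [V.starProjection_orthogonal_val] at h2
    have h3 := he.sum_inner_products_le (V.starProjection y) (s := Finset.range (n + 1))
    have h4 : ∀ i, ‖⟪e i, V.starProjection y⟫_ℂ‖ = ‖⟪e j, M (e i)⟫_ℂ‖ := by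
      intro i
      rw [← Submodule.inner_starProjection_left_eq_right,
        Submodule.starProjection_eq_self_iff.2 (heV i), hy,
        ContinuousLinearMap.adjoint_inner_right, norm_inner_symm]
    simp_rw [h4] at h3
    rw [← hM, ← hy]
    linarith
  have h2 : ∀ i < n, ∑ j ∈ Finset.range (n + 1), ‖⟪e j, M (e i)⟫_ℂ‖ ^ 2 = ‖M (e i)‖ ^ 2 := by
    intro i hi
    refine he.sum_norm_inner_sq_eq_of_mem_span _ (Submodule.span_mono (Set.image_mono ?_) (hMe i))
    intro k hk
    simp only [Set.mem_Iic] at hk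
    simp only [Finset.coe_range, Set.mem_Iio]
    omega
  have h3 : ‖M (e n)‖ ^ 2 ≤ ‖M‖ ^ 2 := by
    refine pow_le_pow_left₀ (norm_nonneg _) ?_ 2
    simpa [he.1 n] using M.le_opNorm (e n)
  calc _ ≤ ∑ j ∈ Finset.range (n + 1),
        (‖M (e j)‖ ^ 2 - ∑ i ∈ Finset.range (n + 1), ‖⟪e j, M (e i)⟫_ℂ‖ ^ 2) :=
        Finset.sum_le_sum fun j _ => h1 j
    _ = ∑ i ∈ Finset.range (n + 1),
        (‖M (e i)‖ ^ 2 - ∑ j ∈ Finset.range (n + 1), ‖⟪e j, M (e i)⟫_ℂ‖ ^ 2) := by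
        rw [Finset.sum_sub_distrib, Finset.sum_sub_distrib, Finset.sum_comm]
    _ = ‖M (e n)‖ ^ 2 - ∑ j ∈ Finset.range (n + 1), ‖⟪e j, M (e n)⟫_ℂ‖ ^ 2 := by
        rw [Finset.sum_range_succ, Finset.sum_eq_zero, zero_add]
        intro i hi
        rw [h2 i (Finset.mem_range.1 hi), sub_self]
    _ ≤ ‖M‖ ^ 2 := (sub_le_self _ (Finset.sum_nonneg fun _ _ => by positivity)).trans h3

end SelfCommutator

/-! ### Multiplication by `z` and polynomials in `L²(μ)` -/

section PolynomialL2

variable (μ : Measure ℂ) (hc : IsCompact μ.support)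

theorem adjoint_mulZ_ae_eq (f : Lp ℂ 2 μ) :
    (ContinuousLinearMap.adjoint (mulZ μ hc)) f =ᵐ[μ] fun z => (starRingEnd ℂ) z * f z := by
  have hconj : MemLp (fun z : ℂ => (starRingEnd ℂ) z) ∞ μ := (memLp_coord μ hc).star
  let N : Lp ℂ 2 μ →L[ℂ] Lp ℂ 2 μ := (ContinuousLinearMap.mul ℂ ℂ).holderL μ ∞ 2 2 hconj.toLp
  have hN : ∀ f : Lp ℂ 2 μ, N f =ᵐ[μ] fun z => (starRingEnd ℂ) z * f z := by
    intro f
    have h1 := (ContinuousLinearMap.mul ℂ ℂ).coeFn_holder (r := 2) hconj.toLp f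
    filter_upwards [h1, hconj.coeFn_toLp] with z h1 h2
    refine h1.trans ?_
    rw [h2]
    rfl
  have hNM : N = ContinuousLinearMap.adjoint (mulZ μ hc) := by
    rw [ContinuousLinearMap.eq_adjoint_iff]
    intro f g
    rw [L2.inner_def, L2.inner_def]
    refine integral_congr_ae ?_
    filter_upwards [hN f, coeFn_mulZ μ hc g] with z h1 h2
    rw [h1, h2]
    simp only [RCLike.inner_apply, map_mul, Complex.conj_conj]
    ring
  rw [← hNM]
  exact hN f

theorem norm_adjoint_mulZ (f : Lp ℂ 2 μ) :
    ‖(ContinuousLinearMap.adjoint (mulZ μ hc)) f‖ = ‖mulZ μ hc f‖ := by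
  rw [Lp.norm_def, Lp.norm_def]
  congr 1
  refine eLpNorm_congr_norm_ae ?_
  filter_upwards [adjoint_mulZ_ae_eq μ hc f, coeFn_mulZ μ hc f] with z h1 h2
  rw [h1, h2, norm_mul, norm_mul, RCLike.norm_conj]

variable [IsFiniteMeasure μ]

theorem memLp_polynomial_eval (hc : IsCompact μ.support) (p : Polynomial ℂ) :
    MemLp (fun z => p.eval z) 2 μ := by
  obtain ⟨C, hC⟩ := hc.exists_bound_of_continuousOn (f := fun z => p.eval z)
    p.continuous.continuousOn
  refine MemLp.of_bound p.continuous.aestronglyMeasurable C ?_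
  filter_upwards [Measure.support_mem_ae (μ := μ)] with z hz using hC z hz

/-- The class in `L²(μ)` of a polynomial. -/
def polyToL2 : Polynomial ℂ →ₗ[ℂ] Lp ℂ 2 μ where
  toFun p := (memLp_polynomial_eval μ hc p).toLp
  map_add' p q := by
    rw [← MemLp.toLp_add]
    congr 1
    ext z
    simp
  map_smul' c p := by
    rw [RingHom.id_apply, ← MemLp.toLp_const_smul]
    congr 1
    ext z
    simp

theorem coeFn_polyToL2 (p : Polynomial ℂ) :
    polyToL2 μ hc p =ᵐ[μ] fun z => p.eval z :=
  (memLp_polynomial_eval μ hc p).coeFn_toLp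

theorem range_polyToL2 : (polyToL2 μ hc).range = polyL2 μ := by
  ext f
  constructor
  · rintro ⟨p, rfl⟩
    exact ⟨p, coeFn_polyToL2 μ hc p⟩
  · rintro ⟨p, hp⟩
    exact ⟨p, Lp.ext ((coeFn_polyToL2 μ hc p).trans hp.symm)⟩

theorem mulZ_polyToL2 (p : Polynomial ℂ) :
    mulZ μ hc (polyToL2 μ hc p) = polyToL2 μ hc (Polynomial.X * p) := by
  refine Lp.ext ?_
  filter_upwards [coeFn_mulZ μ hc (polyToL2 μ hc p), coeFn_polyToL2 μ hc p,
    coeFn_polyToL2 μ hc (Polynomial.X * p)] with z h1 h2 h3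
  rw [h1, h2, h3]
  simp

/-- A polynomial that vanishes almost everywhere vanishes on the infinite support. -/
theorem polyToL2_injective (hinf : μ.support.Infinite) :
    Function.Injective (polyToL2 μ hc) := by
  rw [injective_iff_map_eq_zero]
  intro p hp
  have h0 : ∀ᵐ z ∂μ, p.eval z = 0 := by
    have h1 := coeFn_polyToL2 μ hc p
    rw [hp] at h1
    filter_upwards [h1, Lp.coeFn_zero ℂ 2 μ] with z h1 h2
    rw [← h1, h2]
    rfl
  have hsub : μ.support ⊆ {z | p.eval z = 0} :=
    Measure.support_subset_of_isClosed (isClosed_eq p.continuous continuous_const) h0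
  exact Polynomial.eq_zero_of_infinite_isRoot p (hinf.mono hsub)

/-- The orthonormal polynomials of `μ`. -/
def orthoPoly : ℕ → Lp ℂ 2 μ :=
  InnerProductSpace.gramSchmidtNormed ℂ fun n => polyToL2 μ hc (Polynomial.X ^ n)

theorem orthonormal_orthoPoly (hinf : μ.support.Infinite) :
    Orthonormal ℂ (orthoPoly μ hc) := by
  refine InnerProductSpace.gramSchmidtNormed_orthonormal ?_
  have h := (Polynomial.basisMonomials ℂ).linearIndependent.map' (polyToL2 μ hc)
    (LinearMap.ker_eq_bot.2 (polyToL2_injective μ hc hinf))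
  simpa [Function.comp_def, Polynomial.X_pow_eq_monomial] using h

theorem span_orthoPoly_Iic (n : ℕ) :
    Submodule.span ℂ (orthoPoly μ hc '' Set.Iic n)
      = Submodule.span ℂ ((fun n => polyToL2 μ hc (Polynomial.X ^ n)) '' Set.Iic n) := by
  rw [orthoPoly, InnerProductSpace.span_gramSchmidtNormed, InnerProductSpace.span_gramSchmidt_Iic]

theorem span_range_orthoPoly :
    Submodule.span ℂ (Set.range (orthoPoly μ hc)) = polyL2 μ := by
  rw [orthoPoly, InnerProductSpace.span_gramSchmidtNormed_range,
    InnerProductSpace.span_gramSchmidt, ← range_polyToL2 μ hc, LinearMap.range_eq_map,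
    ← (Polynomial.basisMonomials ℂ).span_eq, Submodule.map_span, ← Set.range_comp]
  simp [Function.comp_def, Polynomial.X_pow_eq_monomial]

theorem orthoPoly_mem_P2 (n : ℕ) : orthoPoly μ hc n ∈ P2 μ := by
  refine (polyL2 μ).le_topologicalClosure ?_
  rw [← span_range_orthoPoly μ hc]
  exact Submodule.subset_span ⟨n, rfl⟩

theorem mulZ_orthoPoly_mem_span (n : ℕ) :
    mulZ μ hc (orthoPoly μ hc n) ∈ Submodule.span ℂ (orthoPoly μ hc '' Set.Iic (n + 1)) := by
  have hmem : orthoPoly μ hc n ∈ Submodule.span ℂ (orthoPoly μ hc '' Set.Iic n) :=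
    Submodule.subset_span ⟨n, Set.self_mem_Iic, rfl⟩
  rw [span_orthoPoly_Iic] at hmem ⊢
  refine Submodule.span_induction ?_ (by simp) ?_ ?_ hmem
  · rintro _ ⟨k, hk, rfl⟩
    refine Submodule.subset_span ⟨k + 1, Nat.succ_le_succ hk, ?_⟩
    simp only [mulZ_polyToL2, pow_succ']
  · intro x y _ _ hx hy
    rw [map_add]
    exact Submodule.add_mem _ hx hy
  · intro c x _ hx
    rw [map_smul]
    exact Submodule.smul_mem _ c hx

theorem mem_orthogonal_P2_of_forall_inner_orthoPoly {x : Lp ℂ 2 μ}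
    (hx : ∀ n, ⟪orthoPoly μ hc n, x⟫_ℂ = 0) : x ∈ (P2 μ)ᗮ := by
  rw [P2, Submodule.orthogonal_closure, ← span_range_orthoPoly μ hc]
  refine mem_orthogonal_span_of_forall_inner_eq_zero ?_
  rintro _ ⟨n, rfl⟩
  exact hx n

theorem not_finiteDimensional_P2 (hc : IsCompact μ.support) (hinf : μ.support.Infinite) :
    ¬ FiniteDimensional ℂ (P2 μ) := by
  intro hfin
  have h := (orthonormal_orthoPoly μ hc hinf).linearIndependent
  have h' : LinearIndependent ℂ fun n => (⟨orthoPoly μ hc n, orthoPoly_mem_P2 μ hc n⟩ : P2 μ) :=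
    LinearIndependent.of_comp (P2 μ).subtype h
  exact Module.Finite.not_linearIndependent_of_infinite _ h'

end PolynomialL2

/-! ### The Hankel operator -/

section Hankel

variable (μ : Measure ℂ) (hc : IsCompact μ.support)

theorem hankel_apply (x : Lp ℂ 2 μ) :
    hankel μ hc x = (ContinuousLinearMap.adjoint (mulZ μ hc)) ((P2 μ).starProjection x)
      - (P2 μ).starProjection ((ContinuousLinearMap.adjoint (mulZ μ hc)) x) := rfl

theorem hankel_apply_of_mem {x : Lp ℂ 2 μ} (hx : x ∈ P2 μ) :
    hankel μ hc x = (ContinuousLinearMap.adjoint (mulZ μ hc)) x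
      - (P2 μ).starProjection ((ContinuousLinearMap.adjoint (mulZ μ hc)) x) := by
  rw [hankel_apply, Submodule.starProjection_eq_self_iff.2 hx]

variable [IsFiniteMeasure μ]

theorem mulZ_mem_P2 {x : Lp ℂ 2 μ} (hx : x ∈ P2 μ) : mulZ μ hc x ∈ P2 μ := by
  have hmaps : Set.MapsTo (mulZ μ hc) (polyL2 μ : Set (Lp ℂ 2 μ)) (polyL2 μ) := by
    rw [← range_polyToL2 μ hc]
    rintro _ ⟨p, rfl⟩
    exact ⟨Polynomial.X * p, (mulZ_polyToL2 μ hc p).symm⟩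
  exact hmaps.closure (mulZ μ hc).continuous hx

theorem adjoint_mulZ_mem_orthogonal_P2 {x : Lp ℂ 2 μ} (hx : x ∈ (P2 μ)ᗮ) :
    (ContinuousLinearMap.adjoint (mulZ μ hc)) x ∈ (P2 μ)ᗮ := by
  rw [Submodule.mem_orthogonal] at hx ⊢
  intro u hu
  rw [ContinuousLinearMap.adjoint_inner_right]
  exact hx _ (mulZ_mem_P2 μ hc hu)

theorem hankel_apply_of_mem_orthogonal {x : Lp ℂ 2 μ} (hx : x ∈ (P2 μ)ᗮ) :
    hankel μ hc x = 0 := by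
  rw [hankel_apply, (Submodule.starProjection_apply_eq_zero_iff _).2 hx,
    (Submodule.starProjection_apply_eq_zero_iff _).2 (adjoint_mulZ_mem_orthogonal_P2 μ hc hx),
    map_zero, sub_zero]

theorem hankel_apply_mem_orthogonal (x : Lp ℂ 2 μ) :
    hankel μ hc x ∈ (P2 μ)ᗮ := by
  have h : hankel μ hc x = hankel μ hc ((P2 μ).starProjection x) := by
    rw [← sub_eq_zero, ← map_sub]
    exact hankel_apply_of_mem_orthogonal μ hc ((P2 μ).sub_starProjection_mem_orthogonal x)
  rw [h, hankel_apply_of_mem μ hc ((P2 μ).starProjection_apply_mem x)]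
  exact (P2 μ).sub_starProjection_mem_orthogonal _

theorem hsNormSq_hankel_lt_top (hinf : μ.support.Infinite) :
    hsNormSq (hankel μ hc) < ∞ := by
  have he := orthonormal_orthoPoly μ hc hinf
  have hmem := orthoPoly_mem_P2 μ hc
  rw [hsNormSq_eq_tsum_of_orthonormal (hankel μ hc) (orthoPoly μ hc) he fun x hx =>
    hankel_apply_of_mem_orthogonal μ hc (mem_orthogonal_P2_of_forall_inner_orthoPoly μ hc hx)]
  refine lt_of_le_of_lt ?_ (ENNReal.ofReal_lt_top (r := ‖mulZ μ hc‖ ^ 2))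
  rw [ENNReal.tsum_eq_iSup_nat]
  refine iSup_le fun n => ?_
  simp_rw [← ofReal_norm, ← ENNReal.ofReal_pow (norm_nonneg _)]
  rw [← ENNReal.ofReal_sum_of_nonneg fun _ _ => by positivity]
  refine ENNReal.ofReal_le_ofReal ?_
  simp_rw [fun j => hankel_apply_of_mem μ hc (hmem j)]
  exact sum_norm_sub_starProjection_adjoint_sq_le (P2 μ) (mulZ μ hc) (norm_adjoint_mulZ μ hc) he
    hmem (mulZ_orthoPoly_mem_span μ hc) n

end Hankel

end

theorem mainTheorem8 (μ : Measure ℂ) [IsFiniteMeasure μ]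
    (hc : IsCompact μ.support) (hinf : μ.support.Infinite) :
    -- the Hankel operator is Hilbert-Schmidt, with singular numbers `κ₀ ≥ κ₁ ≥ … ≥ 0`
    hsNormSq (hankel μ hc) < ∞ ∧
    Antitone (singularNumber (hankel μ hc)) ∧
    (∀ j, 0 ≤ singularNumber (hankel μ hc) j) ∧
    -- it has a Schmidt expansion
    (∃ f g : ℕ → Lp ℂ 2 μ, IsSchmidtExpansion (P2 μ) (hankel μ hc) f g) ∧
    -- the lower bound for projections of rank `d` onto a subspace of `P²(μ)`
    (∀ (d : ℕ) (Q : Lp ℂ 2 μ →L[ℂ] Lp ℂ 2 μ), IsStarProjection Q → Q.range ≤ P2 μ →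
      FiniteDimensional ℂ Q.range → Module.finrank ℂ Q.range = d →
      ∑' j : ℕ, ENNReal.ofReal (singularNumber (hankel μ hc) (d + j) ^ 2)
        ≤ hsNormSq (hankel μ hc ∘L (ContinuousLinearMap.id ℂ (Lp ℂ 2 μ) - Q))) ∧
    -- equality for the projection onto the span of the first `d` Schmidt vectors
    (∀ f g : ℕ → Lp ℂ 2 μ, IsSchmidtExpansion (P2 μ) (hankel μ hc) f g →
      ∀ (d : ℕ) (Q : Lp ℂ 2 μ →L[ℂ] Lp ℂ 2 μ), IsStarProjection Q →
        Q.range = Submodule.span ℂ (f '' Set.Iio d) →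
        hsNormSq (hankel μ hc ∘L (ContinuousLinearMap.id ℂ (Lp ℂ 2 μ) - Q))
          = ∑' j : ℕ, ENNReal.ofReal (singularNumber (hankel μ hc) (d + j) ^ 2)) := by
  have hHS := hsNormSq_hankel_lt_top μ hc hinf
  obtain ⟨f, s, hs⟩ := exists_isSingularSystem (P2 μ) (polyL2 μ).isClosed_topologicalClosure
    (not_finiteDimensional_P2 μ hc hinf) (hankel μ hc)
    (isCompactOperator_of_hsNormSq_lt_top _ hHS)
    fun x hx => hankel_apply_of_mem_orthogonal μ hc hx
  have hsing : singularNumber (hankel μ hc) = s := funext hs.singularNumber_eq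
  have hanti : Antitone (singularNumber (hankel μ hc)) := hsing ▸ hs.antitone
  have hnonneg : ∀ j, 0 ≤ singularNumber (hankel μ hc) j := hsing ▸ hs.nonneg
  have hexp := hs.isSchmidtExpansion hHS (hankel_apply_mem_orthogonal μ hc)
  refine ⟨hHS, hanti, hnonneg, ⟨_, _, hexp⟩, ?_, ?_⟩
  · rintro d Q hQ - hfin rfl
    exact hexp.tsum_singularNumber_sq_le hanti hnonneg hQ
  · intro f g h d Q hQ hrange
    exact h.hsNormSq_comp_id_sub_eq d hQ hrange
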